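/- **Theorem 2.** Let $E$ and $Z$ be real reflexive Banach spaces with $E$ compactly embedded into $Z$ (so that $E$ is regarded as a linear subspace of $Z$, the inclusion being continuous and compact). Let $\Phi:E\to\mathbb R$ and $H:Z\to\mathbb R$ be convex and Fréchet differentiable, with derivatives $\varphi:E\to E^*$ and $h:Z\to Z^*$, and suppose that there are constants $\alpha>1$ and $\gamma>0$ with $$\gamma\|v\|^{\alpha}\le\langle\varphi(v),v\rangle\qquad\text{for all }v\in E.$$ Let $\rho>0$, let $B_\rho$ be the closed ball of radius $\rho$ centred at $0$ in $E$, and suppose that $x\mapsto\|h(x)\|_{Z^*}$ is bounded on $B_\rho$. For $\lambda>0$ put $J_\lambda(x)=\Phi(x)-\lambda H(x)$, $x\in E$; a critical point of $J_\lambda$ is a point $x\in E$ with $J_\lambda'(x)=0$. Then there is $\lambda^*>0$ such that the following holds for every $\lambda\in(0,\lambda^*]$. (i) $J_\lambda$ attains its infimum over $B_\rho$. Every $u\in B_\rho$ with $J_\lambda(u)=\inf_{B_\rho}J_\lambda$ (possibly on the boundary of the ball) is a critical point of $J_\lambda$, that is, $\varphi(u)=\lambda h(u)$ in $E^*$. If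 $J_\lambda(0)=0$ and $J_\lambda(v)<0$ for some $v\in B_\rho$, then $u\neq0$. (ii) Let $u\in B_\rho$ be such a minimizer, and assume in addition that (a) $J_\lambda$ satisfies the Palais–Smale condition: every sequence $(x_n)$ in $E$ with $(J_\lambda(x_n))$ bounded and $J_\lambda'(x_n)\to0$ in $E^*$ has a norm convergent subsequence; (b) $J_\lambda(u)<\inf\{J_\lambda(x):\|x\|=\rho_1\}$ for some $\rho_1>\|u\|$; (c) there is $w\in E$ with $\lim_{t\to\infty}J_\lambda(tw)=-\infty$. Then $J_\lambda$ has, besides $u$, another critical point $z$ with $z\neq0$ and $z\neq u$. -/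

import Mathlib

open Filter Topology

/-- A real normed space is reflexive if the canonical isometric inclusion into its topological
bidual is onto. -/
def IsReflexiveSpace (X : Type*) [NormedAddCommGroup X] [NormedSpace ℝ X] : Prop :=
  Function.Surjective (NormedSpace.inclusionInDoubleDual ℝ X)

/-- A compact embedding: an injective continuous linear map that is a compact operator. -/
structure IsCompactEmbedding {E Z : Type*} [NormedAddCommGroup E] [NormedSpace ℝ E]
    [NormedAddCommGroup Z] [NormedSpace ℝ Z] (ι : E →L[ℝ] Z) : Prop where
  injective : Function.Injective ι
  compact : IsCompactOperator ι

/-- The action functional `J = Φ - λ H` on `E`, where `E` is regarded as a subspace of `Z`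
through `ι`. -/
def actionFunctional {E Z : Type*} [NormedAddCommGroup E] [NormedSpace ℝ E]
    [NormedAddCommGroup Z] [NormedSpace ℝ Z] (ι : E →L[ℝ] Z) (Φ : E → ℝ) (H : Z → ℝ) (lam : ℝ) :
    E → ℝ :=
  fun x => Φ x - lam * H (ι x)

/-- `u` is a critical point of `J`: `J` is Fréchet differentiable at `u` with derivative `0`. -/
def IsCriticalPoint {E : Type*} [NormedAddCommGroup E] [NormedSpace ℝ E] (J : E → ℝ) (u : E) :
    Prop :=
  HasFDerivAt J (0 : StrongDual ℝ E) u

/-- The Palais–Smale condition for a differentiable functional: every sequence along which `J` is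
bounded and `J'` tends to `0` in the dual norm has a norm convergent subsequence. -/
def PalaisSmale {E : Type*} [NormedAddCommGroup E] [NormedSpace ℝ E] (J : E → ℝ) : Prop :=
  Differentiable ℝ J ∧
    ∀ x : ℕ → E, (∃ C : ℝ, ∀ n, |J (x n)| ≤ C) →
      Tendsto (fun n => fderiv ℝ J (x n)) atTop (𝓝 0) →
      ∃ (a : E) (σ : ℕ → ℕ), StrictMono σ ∧ Tendsto (x ∘ σ) atTop (𝓝 a)

/-!
`Φ` exceeds `Φ 0` by a fixed amount on the sphere of radius `ρ`, while by compactness of the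
embedding `H` is bounded there. For small `λ` the functional `J = Φ - λ H` is therefore larger than
`J 0` by a fixed margin on that sphere. So minimizers over the ball, which exist by weak lower
semicontinuity, are interior and hence critical; and since the sphere separates `0` from the far
points of a ray along which `J → -∞`, the mountain pass theorem gives a critical point `z` with
`J u ≤ J 0 < J z`, which differs from both `0` and `u`.

For the minimax step, Ekeland's principle yields a path that is almost optimal for the maximum of
`J`. If `J'` were large at every maximum point of the path, a partition of unity would give a field
of descent directions vanishing at the end points, and moving along it would improve the path.
-/

section WeakTopology

variable {E Z : Type*} [NormedAddCommGroup E] [NormedSpace ℝ E]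
  [NormedAddCommGroup Z] [NormedSpace ℝ Z]

theorem IsReflexiveSpace.isCompact_toWeakSpace_image (hE : IsReflexiveSpace E) {s : Set E}
    (hconv : Convex ℝ s) (hclosed : IsClosed s) (hbdd : Bornology.IsBounded s) :
    IsCompact (toWeakSpace ℝ E '' s) := by
  have hrange : Set.range (NormedSpace.inclusionInDoubleDualWeak ℝ E) = Set.univ :=
    Set.range_eq_univ.2 hE
  have hcompact := NormedSpace.isCompact_closure_of_isBounded ℝ E (toWeakSpace ℝ E '' s)
    (by rwa [Set.preimage_image_eq _ (toWeakSpace ℝ E).injective]) (hrange ▸ Set.subset_univ _)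
  rwa [← hconv.toWeakSpace_closure ℝ, hclosed.closure_eq] at hcompact

theorem lowerSemicontinuous_comp_toWeakSpace_symm {f : E → ℝ} (hf : ConvexOn ℝ Set.univ f)
    (hlsc : LowerSemicontinuous f) : LowerSemicontinuous (f ∘ (toWeakSpace ℝ E).symm) := by
  refine lowerSemicontinuous_iff_isClosed_preimage.2 fun c => ?_
  have hconv : Convex ℝ (f ⁻¹' Set.Iic c) :=
    (by simpa using hf.convex_le c : Convex ℝ {x | f x ≤ c})
  have himage := hconv.toWeakSpace_closure ℝ
  rw [(hlsc.isClosed_preimage c).closure_eq, LinearEquiv.image_eq_preimage_symm] at himage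
  exact isClosed_of_closure_subset himage.ge

theorem continuousOn_comp_toWeakSpace_symm_of_isCompactOperator {ι : E →L[ℝ] Z}
    (hι : IsCompactOperator ι) {s : Set E} (hs : Bornology.IsBounded s) :
    ContinuousOn (ι ∘ (toWeakSpace ℝ E).symm) (toWeakSpace ℝ E '' s) := by
  obtain ⟨r, hr⟩ := hs.subset_closedBall 0
  obtain ⟨K, hK, hιK⟩ := IsCompactOperator.image_closedBall_subset_compact
    (f := (ι : E →ₗ[ℝ] Z)) hι r
  intro x _
  refine hK.tendsto_nhds_of_unique_mapClusterPt ?_ fun z _ hz => ?_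
  · filter_upwards [self_mem_nhdsWithin]
    rintro _ ⟨y, hy, rfl⟩
    exact hιK ⟨y, hr hy, by simp⟩
  · refine (SeparatingDual.eq_iff_forall_dual_eq (R := ℝ)).2 fun g => ?_
    have hweak : Tendsto (fun y => g (ι ((toWeakSpace ℝ E).symm y)))
        (𝓝[toWeakSpace ℝ E '' s] x) (𝓝 (g (ι ((toWeakSpace ℝ E).symm x)))) :=
      (WeakBilin.eval_continuous (topDualPairing ℝ E).flip (g.comp ι)).continuousWithinAt
    have hcluster := hz.continuousAt_comp g.continuous.continuousAt
    exact eq_of_nhds_neBot (ClusterPt.mono hcluster hweak)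

theorem IsReflexiveSpace.exists_isMinOn (hE : IsReflexiveSpace E) {J : E → ℝ} {s : Set E}
    (hne : s.Nonempty) (hconv : Convex ℝ s) (hclosed : IsClosed s) (hbdd : Bornology.IsBounded s)
    (hJ : LowerSemicontinuousOn (J ∘ (toWeakSpace ℝ E).symm) (toWeakSpace ℝ E '' s)) :
    ∃ u ∈ s, IsMinOn J s u := by
  obtain ⟨_, ⟨u, hu, rfl⟩, hmin⟩ :=
    hJ.exists_isMinOn (hne.image _) (hE.isCompact_toWeakSpace_image hconv hclosed hbdd)
  exact ⟨u, hu, fun v hv => by simpa using hmin (Set.mem_image_of_mem _ hv)⟩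

theorem IsReflexiveSpace.exists_isMinOn_actionFunctional (hE : IsReflexiveSpace E) {ι : E →L[ℝ] Z}
    (hι : IsCompactOperator ι) {Φ : E → ℝ} {H : Z → ℝ} (hΦ : ConvexOn ℝ Set.univ Φ)
    (hlsc : LowerSemicontinuous Φ) (hH : Continuous H) (lam : ℝ) {s : Set E} (hne : s.Nonempty)
    (hconv : Convex ℝ s) (hclosed : IsClosed s) (hbdd : Bornology.IsBounded s) :
    ∃ u ∈ s, IsMinOn (actionFunctional ι Φ H lam) s u := by
  refine hE.exists_isMinOn hne hconv hclosed hbdd ?_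
  have hHι : ContinuousOn (fun x => -(lam * H (ι ((toWeakSpace ℝ E).symm x))))
      (toWeakSpace ℝ E '' s) :=
    ((hH.comp_continuousOn
      (continuousOn_comp_toWeakSpace_symm_of_isCompactOperator hι hbdd)).const_mul lam).neg
  exact ((lowerSemicontinuous_comp_toWeakSpace_symm hΦ hlsc).lowerSemicontinuousOn _).add
    hHι.lowerSemicontinuousOn

theorem isBounded_image_comp_of_isCompactOperator {Y : Type*} [PseudoMetricSpace Y] {ι : E →L[ℝ] Z}
    (hι : IsCompactOperator ι) {H : Z → Y} (hH : Continuous H) {s : Set E}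
    (hs : Bornology.IsBounded s) : Bornology.IsBounded ((H ∘ ι) '' s) := by
  obtain ⟨r, hr⟩ := hs.subset_closedBall 0
  obtain ⟨K, hK, hιK⟩ := IsCompactOperator.image_closedBall_subset_compact
    (f := (ι : E →ₗ[ℝ] Z)) hι r
  refine (hK.image hH).isBounded.subset ?_
  rw [Set.image_comp]
  exact Set.image_mono ((Set.image_mono hr).trans hιK)

end WeakTopology

section Ekeland

variable {X : Type*} [MetricSpace X] {f : X → ℝ} {ε : ℝ} {x y : X}

/-- The points below `x` in the Ekeland order: those `y` at which the decrease of `f` pays for the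
distance travelled at the rate `ε`. -/
def ekelandSet (f : X → ℝ) (ε : ℝ) (x : X) : Set X :=
  {y | f y + ε * dist x y ≤ f x}

theorem mem_ekelandSet : y ∈ ekelandSet f ε x ↔ f y + ε * dist x y ≤ f x :=
  Iff.rfl

theorem self_mem_ekelandSet (x : X) : x ∈ ekelandSet f ε x := by
  simp [mem_ekelandSet]

theorem ekelandSet_subset (hε : 0 ≤ ε) (hy : y ∈ ekelandSet f ε x) :
    ekelandSet f ε y ⊆ ekelandSet f ε x := by
  intro z hz
  rw [mem_ekelandSet] at hy hz ⊢
  have htriangle : ε * dist x z ≤ ε * (dist x y + dist y z) := by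
    gcongr
    exact dist_triangle x y z
  linarith

theorem isClosed_ekelandSet (hf : LowerSemicontinuous f) (x : X) :
    IsClosed (ekelandSet f ε x) := by
  have hlsc : LowerSemicontinuous fun y => f y + ε * dist x y :=
    hf.add (Continuous.lowerSemicontinuous (by fun_prop))
  exact hlsc.isClosed_preimage (f x)

theorem exists_mem_ekelandSet_subset_closedBall (hbdd : BddBelow (Set.range f)) (hε : 0 < ε)
    (x : X) {δ : ℝ} (hδ : 0 < δ) :
    ∃ y ∈ ekelandSet f ε x, ekelandSet f ε y ⊆ Metric.closedBall y δ := by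
  have hbdd' : BddBelow (f '' ekelandSet f ε x) := hbdd.mono (Set.image_subset_range _ _)
  obtain ⟨_, ⟨y, hy, rfl⟩, hlt⟩ := exists_lt_of_csInf_lt
    (Set.Nonempty.image f ⟨x, self_mem_ekelandSet x⟩)
    (lt_add_of_pos_right (sInf (f '' ekelandSet f ε x)) (mul_pos hε hδ))
  refine ⟨y, hy, fun z hz => ?_⟩
  have hinf := csInf_le hbdd' (Set.mem_image_of_mem f (ekelandSet_subset hε.le hy hz))
  rw [mem_ekelandSet] at hz
  rw [Metric.mem_closedBall, dist_comm]
  refine le_of_mul_le_mul_left ?_ hε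
  linarith

-- Ekeland's variational principle: `ekelandSet f ε a = {a}` says that `a` is the strict minimizer
-- of `f + ε * dist a ·`.
theorem exists_mem_ekelandSet_eq_singleton [CompleteSpace X] (hf : LowerSemicontinuous f)
    (hbdd : BddBelow (Set.range f)) (hε : 0 < ε) (x₀ : X) :
    ∃ a ∈ ekelandSet f ε x₀, ekelandSet f ε a = {a} := by
  let δ : ℕ → ℝ := fun n => 1 / ((n : ℝ) + 1)
  have hδ (n : ℕ) : 0 < δ n := Nat.one_div_pos_of_nat
  have hδlim : Tendsto (fun n => 2 * δ n) atTop (𝓝 0) := by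
    simpa only [mul_zero] using
      (tendsto_one_div_add_atTop_nhds_zero_nat (𝕜 := ℝ)).const_mul (2 : ℝ)
  choose next hnext_mem hnext_ball using
    fun x n => exists_mem_ekelandSet_subset_closedBall hbdd hε x (hδ n)
  let x : ℕ → X := fun n => Nat.rec x₀ (fun n y => next y n) n
  let S : ℕ → Set X := fun n => ekelandSet f ε (x n)
  have hanti : Antitone S :=
    antitone_nat_of_succ_le fun n => ekelandSet_subset hε.le (hnext_mem (x n) n)
  have hball (n : ℕ) : S (n + 1) ⊆ Metric.closedBall (x (n + 1)) (δ n) := hnext_ball (x n) n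
  have hdiam (n : ℕ) : Metric.diam (S (n + 1)) ≤ 2 * δ n :=
    (Metric.diam_mono (hball n) Metric.isBounded_closedBall).trans
      (Metric.diam_closedBall (hδ n).le)
  have hbounded (n : ℕ) : Bornology.IsBounded (S (n + 1)) :=
    Metric.isBounded_closedBall.subset (hball n)
  obtain ⟨a, ha⟩ : (⋂ n, S (n + 1)).Nonempty := by
    refine Metric.nonempty_iInter_of_nonempty_biInter
      (fun n => isClosed_ekelandSet hf _) hbounded (fun N => ⟨x (N + 1), ?_⟩)
      (squeeze_zero (fun _ => Metric.diam_nonneg) hdiam hδlim)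
    exact Set.mem_iInter₂.2 fun n hn =>
      hanti (Nat.succ_le_succ hn) (self_mem_ekelandSet (x (N + 1)))
  rw [Set.mem_iInter] at ha
  refine ⟨a, hanti (Nat.zero_le 1) (ha 0),
    Set.Subset.antisymm (fun y hy => ?_) (Set.singleton_subset_iff.2 (self_mem_ekelandSet a))⟩
  have hdist (n : ℕ) : dist y a ≤ 2 * δ n :=
    (Metric.dist_le_diam_of_mem (hbounded n) (ekelandSet_subset hε.le (ha n) hy) (ha n)).trans
      (hdiam n)
  exact dist_le_zero.1 (ge_of_tendsto' hδlim hdist)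

end Ekeland

section Derivative

variable {E : Type*} [NormedAddCommGroup E] [NormedSpace ℝ E]

theorem hasFDerivAt_apply_sub_le_of_convexOn {f : E → ℝ} {f' : StrongDual ℝ E} {s : Set E} {x y : E}
    (hf : ConvexOn ℝ s f) (hx : x ∈ s) (hy : y ∈ s) (hf' : HasFDerivAt f f' x) :
    f' (y - x) ≤ f y - f x := by
  have hline : ConvexOn ℝ (AffineMap.lineMap x y ⁻¹' s) (f ∘ AffineMap.lineMap x y) :=
    hf.comp_affineMap (AffineMap.lineMap x y : ℝ →ᵃ[ℝ] E)
  have hderiv : HasDerivAt (f ∘ AffineMap.lineMap x y) (f' (y - x)) (0 : ℝ) :=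
    HasFDerivAt.comp_hasDerivAt _ (by simpa using hf') AffineMap.hasDerivAt_lineMap
  have hslope := hline.le_slope_of_hasDerivAt (x := 0) (y := 1) (by simpa using hx)
    (by simpa using hy) one_pos hderiv
  simpa [slope_def_field] using hslope

-- The right-hand side is the Fréchet remainder at `x`, so differentiability at `x` alone controls
-- how much the derivative oscillates near `x`.
theorem fderiv_sub_fderiv_apply_le_of_convexOn {f : E → ℝ} (hf : ConvexOn ℝ Set.univ f)
    (hd : Differentiable ℝ f) (x y k : E) :
    (fderiv ℝ f y - fderiv ℝ f x) k ≤ f (y + k) - f x - fderiv ℝ f x (y + k - x) := by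
  have hy := hasFDerivAt_apply_sub_le_of_convexOn hf (Set.mem_univ y) (Set.mem_univ (y + k))
    (hd y).hasFDerivAt
  have hx := hasFDerivAt_apply_sub_le_of_convexOn hf (Set.mem_univ x) (Set.mem_univ y)
    (hd x).hasFDerivAt
  rw [add_sub_cancel_left] at hy
  rw [sub_apply, add_sub_right_comm, map_add]
  linarith

theorem norm_le_of_forall_norm_eq_apply_le {f : StrongDual ℝ E} {r C : ℝ} (hr : 0 < r) (hC : 0 ≤ C)
    (hf : ∀ k, ‖k‖ = r → f k ≤ C * r) : ‖f‖ ≤ C := by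
  refine ContinuousLinearMap.opNorm_le_of_unit_norm hC fun z hz => ?_
  have hnorm : ‖r • z‖ = r := by rw [norm_smul, hz, mul_one, Real.norm_of_nonneg hr.le]
  have hpos := hf (r • z) hnorm
  have hneg := hf (-(r • z)) (by rwa [norm_neg])
  rw [map_neg, map_smul, smul_eq_mul] at hneg
  rw [map_smul, smul_eq_mul] at hpos
  rw [Real.norm_eq_abs, abs_le]
  constructor <;> nlinarith

theorem contDiff_one_of_convexOn {f : E → ℝ} (hf : ConvexOn ℝ Set.univ f)
    (hd : Differentiable ℝ f) : ContDiff ℝ 1 f := by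
  refine contDiff_one_iff_fderiv.2 ⟨hd, continuous_iff_continuousAt.2 fun x => ?_⟩
  refine Metric.tendsto_nhds.2 fun ε hε => ?_
  have hlittle := (hasFDerivAt_iff_isLittleO.1 (hd x).hasFDerivAt).bound
    (by positivity : 0 < ε / 4)
  obtain ⟨δ, hδ, hball⟩ := Metric.eventually_nhds_iff.1 hlittle
  have hδ3 : 0 < δ / 3 := by positivity
  filter_upwards [Metric.ball_mem_nhds x hδ3] with y hy
  rw [mem_ball_iff_norm] at hy
  have hle : ‖fderiv ℝ f y - fderiv ℝ f x‖ ≤ ε / 2 := by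
    refine norm_le_of_forall_norm_eq_apply_le hδ3 (by positivity) fun k hk => ?_
    have hyk : ‖y + k - x‖ ≤ 2 * (δ / 3) := by
      rw [add_sub_right_comm]
      linarith [norm_add_le (y - x) k]
    calc (fderiv ℝ f y - fderiv ℝ f x) k
        ≤ f (y + k) - f x - fderiv ℝ f x (y + k - x) :=
          fderiv_sub_fderiv_apply_le_of_convexOn hf hd x y k
      _ ≤ ε / 4 * ‖y + k - x‖ :=
          (Real.le_norm_self _).trans (hball (by rw [dist_eq_norm]; linarith))
      _ ≤ ε / 4 * (2 * (δ / 3)) := by gcongr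
      _ = ε / 2 * (δ / 3) := by ring
  rw [dist_eq_norm]
  linarith

theorem add_div_mul_rpow_le_of_hasDerivAt {g g' : ℝ → ℝ} {α c t : ℝ} (hα : 0 < α)
    (hcont : ContinuousOn g (Set.Ici 0)) (hg : ∀ s, 0 < s → HasDerivAt g (g' s) s)
    (hle : ∀ s, 0 < s → c * s ^ (α - 1) ≤ g' s) (ht : 0 ≤ t) : g 0 + c / α * t ^ α ≤ g t := by
  have hmono : MonotoneOn (fun s => g s - c / α * s ^ α) (Set.Ici 0) := by
    refine monotoneOn_of_hasDerivWithinAt_nonneg (f' := fun s => g' s - c / α * (α * s ^ (α - 1)))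
      (convex_Ici 0)
      (hcont.sub (continuous_const.mul (Real.continuous_rpow_const hα.le)).continuousOn)
      (fun s hs => ?_) fun s hs => ?_
    all_goals rw [interior_Ici, Set.mem_Ioi] at hs
    · exact ((hg s hs).sub
        ((Real.hasDerivAt_rpow_const (Or.inl hs.ne')).const_mul _)).hasDerivWithinAt
    · rw [← mul_assoc, div_mul_cancel₀ _ hα.ne']
      exact sub_nonneg.2 (hle s hs)
  have hzero := hmono Set.self_mem_Ici ht ht
  simp only [Real.zero_rpow hα.ne', mul_zero, sub_zero] at hzero
  linarith

theorem add_div_mul_norm_rpow_le_of_hasFDerivAt {f : E → ℝ} {f' : E → StrongDual ℝ E} {α γ : ℝ}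
    (hα : 0 < α) (hf : ∀ x, HasFDerivAt f (f' x) x) (hgrowth : ∀ x, γ * ‖x‖ ^ α ≤ f' x x) (x : E) :
    f 0 + γ / α * ‖x‖ ^ α ≤ f x := by
  have hcont : Continuous f := continuous_iff_continuousAt.2 fun x => (hf x).continuousAt
  have hderiv (s : ℝ) : HasDerivAt (fun s : ℝ => f (s • x)) (f' (s • x) x) s := by
    have hray : HasDerivAt (fun s : ℝ => s • x) x s := by
      simpa using (hasDerivAt_id s).smul_const x
    exact (hf (s • x)).comp_hasDerivAt s hray
  have hlower (s : ℝ) (hs : 0 < s) : γ * ‖x‖ ^ α * s ^ (α - 1) ≤ f' (s • x) x := by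
    refine le_of_mul_le_mul_left ?_ hs
    calc s * (γ * ‖x‖ ^ α * s ^ (α - 1)) = γ * ‖s • x‖ ^ α := by
          rw [norm_smul, Real.norm_of_nonneg hs.le, Real.mul_rpow hs.le (norm_nonneg x),
            Real.rpow_sub_one hs.ne']
          field_simp
      _ ≤ f' (s • x) (s • x) := hgrowth (s • x)
      _ = s * f' (s • x) x := by rw [map_smul, smul_eq_mul]
  have hone := add_div_mul_rpow_le_of_hasDerivAt hα (by fun_prop) (fun s _ => hderiv s) hlower
    zero_le_one
  simpa [mul_div_right_comm] using hone

end Derivative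

section Descent

variable {X E : Type*} [TopologicalSpace X] [NormedAddCommGroup E] [NormedSpace ℝ E]

theorem eventually_apply_add_smul_lt_of_hasStrictFDerivAt {f : E → ℝ} {f' : StrongDual ℝ E}
    {x v : E} {c : ℝ} (hf : HasStrictFDerivAt f f' x) (hv : f' v < c) :
    ∀ᶠ p : ℝ × E × E in 𝓝 (0, x, v),
      0 < p.1 → f (p.2.1 + p.1 • p.2.2) < f p.2.1 + p.1 * c := by
  obtain ⟨η, hη, hlt⟩ : ∃ η > 0, f' v + η * ‖v‖ < c := by
    have hcont : Tendsto (fun η : ℝ => f' v + η * ‖v‖) (𝓝[>] 0) (𝓝 (f' v + 0 * ‖v‖)) :=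
      (Continuous.tendsto (by fun_prop) 0).mono_left nhdsWithin_le_nhds
    rw [zero_mul, add_zero] at hcont
    exact ((hcont.eventually_lt_const hv).and self_mem_nhdsWithin).exists.imp fun η h => h.symm
  have hpair : Tendsto (fun p : ℝ × E × E => (p.2.1 + p.1 • p.2.2, p.2.1)) (𝓝 (0, x, v))
      (𝓝 (x, x)) :=
    Continuous.tendsto' (by fun_prop) _ _ (by simp)
  have hslope : ∀ᶠ p : ℝ × E × E in 𝓝 (0, x, v), f' p.2.2 + η * ‖p.2.2‖ < c :=
    (isOpen_lt (by fun_prop) continuous_const).mem_nhds hlt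
  filter_upwards [hpair.eventually (hf.isLittleO.bound hη), hslope] with p hp hslope hpos
  rw [add_sub_cancel_left, map_smul, smul_eq_mul, norm_smul, Real.norm_of_nonneg hpos.le] at hp
  have hstep := (Real.le_norm_self _).trans hp
  have hscaled := mul_lt_mul_of_pos_left hslope hpos
  linarith

theorem eventually_forall_apply_add_smul_lt [CompactSpace X] {J : E → ℝ} (hJ : ContDiff ℝ 1 J)
    (g v : C(X, E)) {ε m : ℝ} (hle : ∀ t, J (g t) ≤ m)
    (hv : ∀ t, J (g t) = m → fderiv ℝ J (g t) (v t) < -ε) :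
    ∀ᶠ r in 𝓝[>] (0 : ℝ), ∀ t, J (g t + r • v t) + ε * r < m := by
  have hlocal (t : X) : ∀ᶠ p : ℝ × X in 𝓝 (0, t),
      0 < p.1 → J (g p.2 + p.1 • v p.2) + ε * p.1 < m := by
    rcases (hle t).lt_or_eq with hlt | heq
    · have hcont : Continuous fun p : ℝ × X => J (g p.2 + p.1 • v p.2) + ε * p.1 := by
        have := hJ.continuous
        fun_prop
      filter_upwards [(isOpen_lt hcont continuous_const).mem_nhds
        (show J (g t + (0 : ℝ) • v t) + ε * 0 < m by simpa using hlt)] with p hp _ using hp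
    · have htendsto : Tendsto (fun p : ℝ × X => (p.1, g p.2, v p.2)) (𝓝 (0, t))
          (𝓝 (0, g t, v t)) :=
        Continuous.tendsto' (by fun_prop) _ _ rfl
      filter_upwards [htendsto.eventually (eventually_apply_add_smul_lt_of_hasStrictFDerivAt
        (hJ.hasStrictFDerivAt one_ne_zero) (hv t heq))] with p hp hpos
      linarith [hp hpos, hle p.2]
  have hall := isCompact_univ.eventually_forall_of_forall_eventually (x₀ := (0 : ℝ))
    (P := fun r t => 0 < r → J (g t + r • v t) + ε * r < m) fun t _ => hlocal t
  filter_upwards [nhdsWithin_le_nhds hall, self_mem_nhdsWithin] with r hr hpos t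
  exact hr t (Set.mem_univ t) hpos

theorem exists_norm_le_one_apply_lt_of_lt_norm {f : StrongDual ℝ E} {ε : ℝ} (hf : ε < ‖f‖) :
    ∃ c : E, ‖c‖ ≤ 1 ∧ f c < -ε := by
  obtain ⟨x, hx, hlt⟩ := f.exists_lt_apply_of_lt_opNorm hf
  rcases lt_abs.1 hlt with hpos | hneg
  · exact ⟨-x, by simpa using hx.le, by simpa using hpos⟩
  · exact ⟨x, hx.le, lt_neg_of_lt_neg hneg⟩

theorem exists_continuousMap_apply_lt_of_lt_norm [NormalSpace X] [ParacompactSpace X]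
    {f : X → StrongDual ℝ E} (hf : Continuous f) {M A : Set X} (hM : IsClosed M) (hA : IsClosed A)
    (hMA : Disjoint M A) {ε : ℝ} (hε : ∀ t ∈ M, ε < ‖f t‖) :
    ∃ v : C(X, E), (∀ t, ‖v t‖ ≤ 1) ∧ (∀ t ∈ M, f t (v t) < -ε) ∧ ∀ t ∈ A, v t = 0 := by
  let T : X → Set E := fun t => Metric.closedBall 0 1 ∩
    ({c | t ∈ M → f t c < -ε} ∩ {c | t ∈ A → c = 0})
  have hconvex (t : X) : Convex ℝ (T t) := by
    refine (convex_closedBall 0 1).inter (Convex.inter ?_ ?_)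
    · by_cases ht : t ∈ M
      · simpa [ht] using convex_halfSpace_lt (f t).toLinearMap.isLinear (-ε)
      · simpa [ht] using convex_univ
    · by_cases ht : t ∈ A
      · simp [ht]
      · simpa [ht] using convex_univ
  have hlocal (t : X) : ∃ c : E, ∀ᶠ s in 𝓝 t, c ∈ T s := by
    by_cases ht : t ∈ M
    · obtain ⟨c, hc, hlt⟩ := exists_norm_le_one_apply_lt_of_lt_norm (hε t ht)
      have hopen : IsOpen {s | f s c < -ε} := isOpen_lt (by fun_prop) continuous_const
      refine ⟨c, ?_⟩
      filter_upwards [hopen.mem_nhds hlt,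
        hA.isOpen_compl.mem_nhds (hMA.notMem_of_mem_left ht)] with s hs hsA
      exact ⟨mem_closedBall_zero_iff.2 hc, fun _ => hs, fun h => (hsA h).elim⟩
    · refine ⟨0, ?_⟩
      filter_upwards [hM.isOpen_compl.mem_nhds ht] with s hs
      exact ⟨Metric.mem_closedBall_self zero_le_one, fun h => (hs h).elim, fun _ => rfl⟩
  obtain ⟨v, hv⟩ := exists_continuous_forall_mem_convex_of_local_const hconvex hlocal
  exact ⟨v, fun t => mem_closedBall_zero_iff.1 (hv t).1, fun t => (hv t).2.1, fun t => (hv t).2.2⟩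

end Descent

section MaxAlong

variable {X Y : Type*} [TopologicalSpace X] [TopologicalSpace Y] {J : Y → ℝ}

/-- The maximum of `J` along a map `g` from a compact space, the quantity minimized in minimax
arguments; it is only meaningful when `J ∘ g` is bounded above. -/
noncomputable def maxAlong (J : Y → ℝ) (g : C(X, Y)) : ℝ :=
  ⨆ t, J (g t)

/-- The admissible class of a minimax argument: the maps with the same boundary values on `A`
as `g₀`. -/
def mapsAgreeingOn (A : Set X) (g₀ : C(X, Y)) : Set C(X, Y) :=
  {g | Set.EqOn g g₀ A}

theorem isClosed_mapsAgreeingOn [T2Space Y] (A : Set X) (g₀ : C(X, Y)) :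
    IsClosed (mapsAgreeingOn A g₀) := by
  have hinter : mapsAgreeingOn A g₀ = ⋂ a ∈ A, {g : C(X, Y) | g a = g₀ a} := by
    ext g
    simp [mapsAgreeingOn, Set.EqOn]
  rw [hinter]
  exact isClosed_biInter fun a _ => isClosed_eq (by fun_prop) continuous_const

variable [CompactSpace X]

theorem bddAbove_range_apply (hJ : Continuous J) (g : C(X, Y)) :
    BddAbove (Set.range fun t => J (g t)) :=
  (isCompact_range (hJ.comp g.continuous)).bddAbove

theorem le_maxAlong (hJ : Continuous J) (g : C(X, Y)) (t : X) : J (g t) ≤ maxAlong J g :=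
  le_ciSup (bddAbove_range_apply hJ g) t

theorem exists_apply_eq_maxAlong [Nonempty X] (hJ : Continuous J) (g : C(X, Y)) :
    ∃ t, J (g t) = maxAlong J g :=
  (isCompact_range (hJ.comp g.continuous)).sSup_mem (Set.range_nonempty _)

theorem lowerSemicontinuous_maxAlong (hJ : Continuous J) :
    LowerSemicontinuous (maxAlong J : C(X, Y) → ℝ) :=
  lowerSemicontinuous_ciSup (bddAbove_range_apply hJ) fun t =>
    (hJ.comp (continuous_eval_const t)).lowerSemicontinuous

end MaxAlong

section Minimax

variable {E : Type*} [NormedAddCommGroup E] [NormedSpace ℝ E] {J : E → ℝ} {m : ℝ}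

section Linking

variable {X : Type*} [TopologicalSpace X] [CompactSpace X] [T2Space X] {A : Set X} {g₀ : C(X, E)}

theorem exists_apply_eq_maxAlong_norm_fderiv_le [Nonempty X] (hJ : ContDiff ℝ 1 J)
    (hA : IsClosed A) (g : C(X, E)) (hbdry : ∀ a ∈ A, J (g a) < maxAlong J g) {ε : ℝ} (hε : 0 ≤ ε)
    (hmin : ∀ k ∈ mapsAgreeingOn A g, maxAlong J k + ε * dist g k ≤ maxAlong J g → k = g) :
    ∃ t, J (g t) = maxAlong J g ∧ ‖fderiv ℝ J (g t)‖ ≤ ε := by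
  by_contra! hlarge
  have hJ' : Continuous fun t => fderiv ℝ J (g t) :=
    (hJ.continuous_fderiv one_ne_zero).comp g.continuous
  let M : Set X := {t | J (g t) = maxAlong J g}
  have hM : IsClosed M := isClosed_eq (hJ.continuous.comp g.continuous) continuous_const
  have hMA : Disjoint M A := Set.disjoint_left.2 fun t ht htA => (hbdry t htA).ne ht
  obtain ⟨v, hv_norm, hv_descent, hv_zero⟩ :=
    exists_continuousMap_apply_lt_of_lt_norm hJ' hM hA hMA hlarge
  obtain ⟨r, hdecrease, hr⟩ := ((eventually_forall_apply_add_smul_lt hJ g v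
    (le_maxAlong hJ.continuous g) hv_descent).and self_mem_nhdsWithin).exists
  have hdist : dist g (g + r • v) ≤ r := by
    rw [dist_self_add_right, norm_smul, Real.norm_of_nonneg (le_of_lt hr)]
    exact mul_le_of_le_one_right (le_of_lt hr) ((ContinuousMap.norm_le _ zero_le_one).2 hv_norm)
  obtain ⟨t, ht⟩ := exists_apply_eq_maxAlong hJ.continuous (g + r • v)
  have hlower : maxAlong J (g + r • v) + ε * r < maxAlong J g := ht ▸ hdecrease t
  have hfixed : g + r • v = g := by
    refine hmin _ (fun a ha => by simp [hv_zero a ha]) ?_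
    exact (add_le_add_right (mul_le_mul_of_nonneg_left hdist hε) _).trans hlower.le
  rw [hfixed] at hlower
  exact absurd (mul_nonneg hε (le_of_lt hr)) (by linarith)

theorem exists_mem_Icc_norm_fderiv_le_of_forall_mapsAgreeingOn [CompleteSpace E]
    (hJ : ContDiff ℝ 1 J) (hA : IsClosed A) (hbdry : ∀ a ∈ A, J (g₀ a) < m)
    (hlink : ∀ g ∈ mapsAgreeingOn A g₀, ∃ t, m ≤ J (g t)) {ε : ℝ} (hε : 0 < ε) :
    ∃ x, J x ∈ Set.Icc m (maxAlong J g₀) ∧ ‖fderiv ℝ J x‖ ≤ ε := by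
  have hg₀ : g₀ ∈ mapsAgreeingOn A g₀ := Set.eqOn_refl g₀ A
  have : Nonempty X := (hlink g₀ hg₀).nonempty
  have : CompleteSpace (mapsAgreeingOn A g₀) := (isClosed_mapsAgreeingOn A g₀).completeSpace_coe
  have hm : ∀ g ∈ mapsAgreeingOn A g₀, m ≤ maxAlong J g := fun g hg =>
    (hlink g hg).elim fun t ht => ht.trans (le_maxAlong hJ.continuous g t)
  have hlsc : LowerSemicontinuous fun g : mapsAgreeingOn A g₀ => maxAlong J g.1 :=
    (lowerSemicontinuous_maxAlong hJ.continuous).comp continuous_subtype_val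
  obtain ⟨⟨g, hg⟩, hbelow, hsingleton⟩ := exists_mem_ekelandSet_eq_singleton hlsc
    ⟨m, Set.forall_mem_range.2 fun g => hm g.1 g.2⟩ hε ⟨g₀, hg₀⟩
  obtain ⟨t, hmax, hder⟩ := exists_apply_eq_maxAlong_norm_fderiv_le hJ hA g
    (fun a ha => (hg ha).symm ▸ (hbdry a ha).trans_le (hm g hg)) hε.le fun k hk hle =>
      congrArg Subtype.val (hsingleton.subset (mem_ekelandSet.2 hle :
        (⟨k, hk.trans hg⟩ : mapsAgreeingOn A g₀) ∈ _))
  have hle : maxAlong J g ≤ maxAlong J g₀ :=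
    (le_add_of_nonneg_right (mul_nonneg hε.le dist_nonneg)).trans (mem_ekelandSet.1 hbelow)
  exact ⟨g t, hmax ▸ ⟨hm g hg, hle⟩, hder⟩

end Linking

theorem PalaisSmale.exists_isCriticalPoint_of_forall_norm_fderiv_le (hPS : PalaisSmale J)
    (hJ : ContDiff ℝ 1 J) {M : ℝ}
    (halmost : ∀ ε > 0, ∃ x, J x ∈ Set.Icc m M ∧ ‖fderiv ℝ J x‖ ≤ ε) :
    ∃ z, IsCriticalPoint J z ∧ m ≤ J z := by
  choose x hx hder using fun n : ℕ => halmost (1 / ((n : ℝ) + 1)) Nat.one_div_pos_of_nat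
  have hder_lim : Tendsto (fun n => fderiv ℝ J (x n)) atTop (𝓝 0) :=
    squeeze_zero_norm hder tendsto_one_div_add_atTop_nhds_zero_nat
  obtain ⟨z, k, hk, hz⟩ :=
    hPS.2 x ⟨max |m| |M|, fun n => abs_le_max_abs_abs (hx n).1 (hx n).2⟩ hder_lim
  have hzero : fderiv ℝ J z = 0 :=
    tendsto_nhds_unique (((hJ.continuous_fderiv one_ne_zero).tendsto z).comp hz)
      (hder_lim.comp hk.tendsto_atTop)
  refine ⟨z, ?_, ge_of_tendsto' ((hJ.continuous.tendsto z).comp hz) fun n => (hx (k n)).1⟩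
  rw [IsCriticalPoint, ← hzero]
  exact (hJ.differentiable one_ne_zero z).hasFDerivAt

variable [CompleteSpace E]

theorem PalaisSmale.exists_isCriticalPoint_of_linking {X : Type*} [TopologicalSpace X]
    [CompactSpace X] [T2Space X] {A : Set X} {g₀ : C(X, E)} (hPS : PalaisSmale J)
    (hJ : ContDiff ℝ 1 J) (hA : IsClosed A) (hbdry : ∀ a ∈ A, J (g₀ a) < m)
    (hlink : ∀ g ∈ mapsAgreeingOn A g₀, ∃ t, m ≤ J (g t)) :
    ∃ z, IsCriticalPoint J z ∧ m ≤ J z :=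
  hPS.exists_isCriticalPoint_of_forall_norm_fderiv_le hJ fun _ hε =>
    exists_mem_Icc_norm_fderiv_le_of_forall_mapsAgreeingOn hJ hA hbdry hlink hε

open unitInterval in
theorem PalaisSmale.exists_isCriticalPoint_of_mountainPass (hPS : PalaisSmale J)
    (hJ : ContDiff ℝ 1 J) {a b : E} {r : ℝ} (ha : J a < m) (hb : J b < m) (har : ‖a‖ ≤ r)
    (hrb : r ≤ ‖b‖) (hsphere : ∀ x ∈ Metric.sphere (0 : E) r, m ≤ J x) :
    ∃ z, IsCriticalPoint J z ∧ m ≤ J z := by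
  let g₀ : C(I, E) := ⟨fun t => AffineMap.lineMap a b (t : ℝ), by fun_prop⟩
  refine hPS.exists_isCriticalPoint_of_linking hJ (A := {0, 1}) (g₀ := g₀)
    (Set.toFinite _).isClosed (by simpa [g₀] using ⟨ha, hb⟩) fun g hg => ?_
  have hg_zero : g 0 = a := by simpa [g₀] using hg (Set.mem_insert 0 {1})
  have hg_one : g 1 = b := by simpa [g₀] using hg (Set.mem_insert_of_mem 0 rfl)
  obtain ⟨t, ht⟩ := mem_range_of_exists_le_of_exists_ge g.continuous.norm
    ⟨0, hg_zero ▸ har⟩ ⟨1, hg_one ▸ hrb⟩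
  exact ⟨t, hsphere (g t) (mem_sphere_zero_iff_norm.2 ht)⟩

theorem PalaisSmale.exists_isCriticalPoint_of_tendsto_atBot (hPS : PalaisSmale J)
    (hJ : ContDiff ℝ 1 J) {r : ℝ} (hr : 0 ≤ r) (hzero : J 0 < m)
    (hsphere : ∀ x ∈ Metric.sphere (0 : E) r, m ≤ J x) {w : E}
    (hw : Tendsto (fun t : ℝ => J (t • w)) atTop atBot) :
    ∃ z, IsCriticalPoint J z ∧ m ≤ J z := by
  have hw_ne : w ≠ 0 := by
    rintro rfl
    simp only [smul_zero] at hw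
    exact not_tendsto_const_atBot _ _ hw
  have hnorm : Tendsto (fun t : ℝ => ‖t • w‖) atTop atTop := by
    simp only [norm_smul]
    exact tendsto_norm_atTop_atTop.atTop_mul_const (norm_pos_iff.2 hw_ne)
  obtain ⟨t, hlt, hle⟩ := ((hw.eventually_lt_atBot m).and (hnorm.eventually_ge_atTop r)).exists
  exact hPS.exists_isCriticalPoint_of_mountainPass hJ hzero hlt (norm_zero.trans_le hr) hle hsphere

end Minimax

section ActionFunctional

variable {E Z : Type*} [NormedAddCommGroup E] [NormedSpace ℝ E]
  [NormedAddCommGroup Z] [NormedSpace ℝ Z] {ι : E →L[ℝ] Z} {Φ : E → ℝ} {H : Z → ℝ}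

theorem isCriticalPoint_of_isMinOn_closedBall {J : E → ℝ} {u : E} {ρ : ℝ}
    (hJ : DifferentiableAt ℝ J u) (hsphere : ∀ x ∈ Metric.sphere (0 : E) ρ, J 0 < J x)
    (hu : u ∈ Metric.closedBall (0 : E) ρ) (hmin : IsMinOn J (Metric.closedBall 0 ρ) u) :
    IsCriticalPoint J u := by
  have hinterior : u ∈ Metric.ball (0 : E) ρ := by
    refine Metric.mem_ball.2 ((Metric.mem_closedBall.1 hu).lt_of_ne fun hdist => ?_)
    exact (hsphere u hdist).not_ge (hmin (Metric.mem_closedBall_self (dist_nonneg.trans hu)))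
  have hlocal : IsLocalMin J u :=
    hmin.isLocalMin (mem_of_superset (Metric.isOpen_ball.mem_nhds hinterior)
      Metric.ball_subset_closedBall)
  rw [IsCriticalPoint, ← hlocal.fderiv_eq_zero]
  exact hJ.hasFDerivAt

theorem hasFDerivAt_actionFunctional {Φ' : StrongDual ℝ E} {H' : StrongDual ℝ Z} {u : E}
    (hΦ : HasFDerivAt Φ Φ' u) (hH : HasFDerivAt H H' (ι u)) (lam : ℝ) :
    HasFDerivAt (actionFunctional ι Φ H lam) (Φ' - lam • H'.comp ι) u :=
  hΦ.sub ((hH.comp u ι.hasFDerivAt).const_mul lam)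

theorem contDiff_actionFunctional {n : WithTop ℕ∞} (hΦ : ContDiff ℝ n Φ) (hH : ContDiff ℝ n H)
    (lam : ℝ) : ContDiff ℝ n (actionFunctional ι Φ H lam) :=
  hΦ.sub (contDiff_const.mul (hH.comp ι.contDiff))

theorem isCriticalPoint_actionFunctional_iff {Φ' : StrongDual ℝ E} {H' : StrongDual ℝ Z} {u : E}
    (hΦ : HasFDerivAt Φ Φ' u) (hH : HasFDerivAt H H' (ι u)) {lam : ℝ} :
    IsCriticalPoint (actionFunctional ι Φ H lam) u ↔ Φ' = lam • H'.comp ι := by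
  have hder := hasFDerivAt_actionFunctional hΦ hH lam
  refine ⟨fun hu => sub_eq_zero.1 (hder.unique hu), fun heq => ?_⟩
  rwa [sub_eq_zero.2 heq] at hder

theorem exists_forall_abs_le_add_half_le_actionFunctional (hι : IsCompactOperator ι)
    (hH : Continuous H) {δ ρ : ℝ} (hδ : 0 < δ)
    (hgap : ∀ x ∈ Metric.sphere (0 : E) ρ, Φ 0 + δ ≤ Φ x) :
    ∃ lamStar > 0, ∀ lam : ℝ, |lam| ≤ lamStar → ∀ x ∈ Metric.sphere (0 : E) ρ,
      actionFunctional ι Φ H lam 0 + δ / 2 ≤ actionFunctional ι Φ H lam x := by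
  obtain ⟨M, hM, hsub⟩ := (isBounded_image_comp_of_isCompactOperator hι hH
    (Metric.isBounded_sphere (x := 0) (r := ρ))).subset_closedBall_lt 0 (H 0)
  refine ⟨δ / (2 * M), by positivity, fun lam hlam x hx => ?_⟩
  have hHx : |H (ι x) - H 0| ≤ M := hsub ⟨x, hx, rfl⟩
  have hperturb : lam * (H (ι x) - H 0) ≤ δ / 2 := calc
    lam * (H (ι x) - H 0) ≤ |lam| * |H (ι x) - H 0| := (le_abs_self _).trans_eq (abs_mul _ _)
    _ ≤ δ / (2 * M) * M := by gcongr
    _ = δ / 2 := by field_simp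
  have hΦx := hgap x hx
  simp only [actionFunctional, map_zero]
  linarith

end ActionFunctional

theorem theorem2_general {E Z : Type*}
    [NormedAddCommGroup E] [NormedSpace ℝ E] [CompleteSpace E]
    [NormedAddCommGroup Z] [NormedSpace ℝ Z]
    (hE : IsReflexiveSpace E) {ι : E →L[ℝ] Z} (hι : IsCompactOperator ι)
    {Φ : E → ℝ} {H : Z → ℝ} {φ : E → StrongDual ℝ E} {h : Z → StrongDual ℝ Z}
    (hΦ : ConvexOn ℝ Set.univ Φ) (hH : ContDiff ℝ 1 H)
    (hφ : ∀ x, HasFDerivAt Φ (φ x) x) (hh : ∀ z, HasFDerivAt H (h z) z)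
    {δ ρ : ℝ} (hδ : 0 < δ) (hρ : 0 ≤ ρ)
    (hgap : ∀ x ∈ Metric.sphere (0 : E) ρ, Φ 0 + δ ≤ Φ x) :
    ∃ lamStar : ℝ, 0 < lamStar ∧ ∀ lam : ℝ, |lam| ≤ lamStar →
      (∃ u ∈ Metric.closedBall (0 : E) ρ,
        IsMinOn (actionFunctional ι Φ H lam) (Metric.closedBall (0 : E) ρ) u) ∧
      ∀ u ∈ Metric.closedBall (0 : E) ρ,
        IsMinOn (actionFunctional ι Φ H lam) (Metric.closedBall (0 : E) ρ) u →
        IsCriticalPoint (actionFunctional ι Φ H lam) u ∧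
        φ u = lam • (h (ι u)).comp ι ∧
        ((∃ v ∈ Metric.closedBall (0 : E) ρ, actionFunctional ι Φ H lam v < 0) →
          actionFunctional ι Φ H lam 0 = 0 → u ≠ 0) ∧
        (PalaisSmale (actionFunctional ι Φ H lam) →
          (∃ w : E, Tendsto (fun t : ℝ => actionFunctional ι Φ H lam (t • w)) atTop atBot) →
          ∃ z : E, IsCriticalPoint (actionFunctional ι Φ H lam) z ∧ z ≠ 0 ∧ z ≠ u) := by
  obtain ⟨lamStar, hpos, hsphere⟩ :=
    exists_forall_abs_le_add_half_le_actionFunctional hι hH.continuous hδ hgap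
  refine ⟨lamStar, hpos, fun lam hlam => ?_⟩
  have hΦ₁ : ContDiff ℝ 1 Φ := contDiff_one_of_convexOn hΦ fun x => (hφ x).differentiableAt
  have hJ : ContDiff ℝ 1 (actionFunctional ι Φ H lam) := contDiff_actionFunctional hΦ₁ hH lam
  have hzero_mem : (0 : E) ∈ Metric.closedBall 0 ρ := Metric.mem_closedBall_self hρ
  have hmargin := lt_add_of_pos_right (actionFunctional ι Φ H lam 0) (half_pos hδ)
  refine ⟨hE.exists_isMinOn_actionFunctional hι hΦ hΦ₁.continuous.lowerSemicontinuous
    hH.continuous lam ⟨0, hzero_mem⟩ (convex_closedBall 0 ρ) Metric.isClosed_closedBall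
    Metric.isBounded_closedBall, fun u hu hmin => ?_⟩
  have hcritical : IsCriticalPoint (actionFunctional ι Φ H lam) u :=
    isCriticalPoint_of_isMinOn_closedBall (hJ.differentiable one_ne_zero u)
      (fun x hx => hmargin.trans_le (hsphere lam hlam x hx)) hu hmin
  refine ⟨hcritical, (isCriticalPoint_actionFunctional_iff (hφ u) (hh (ι u))).1 hcritical, ?_, ?_⟩
  · rintro ⟨v, hv, hneg⟩ hzero rfl
    exact ((hmin hv).trans_lt hneg).ne hzero
  · rintro hPS ⟨w, hw⟩
    obtain ⟨z, hz, hle⟩ := hPS.exists_isCriticalPoint_of_tendsto_atBot hJ hρ hmargin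
      (hsphere lam hlam) hw
    refine ⟨z, hz, ?_, ?_⟩
    · rintro rfl
      exact hle.not_gt hmargin
    · rintro rfl
      exact hle.not_gt ((hmin hzero_mem).trans_lt hmargin)

theorem theorem2 {E Z : Type*}
    [NormedAddCommGroup E] [NormedSpace ℝ E] [CompleteSpace E]
    [NormedAddCommGroup Z] [NormedSpace ℝ Z] [CompleteSpace Z]
    -- `E` and `Z` are reflexive and `E` is compactly embedded into `Z`
    (hE : IsReflexiveSpace E) (hZ : IsReflexiveSpace Z)
    (ι : E →L[ℝ] Z) (hι : IsCompactEmbedding ι)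
    -- `Φ` and `H` are convex with Fréchet derivatives `φ` and `h`
    (Φ : E → ℝ) (H : Z → ℝ) (φ : E → StrongDual ℝ E) (h : Z → StrongDual ℝ Z)
    (hΦconv : ConvexOn ℝ Set.univ Φ) (hHconv : ConvexOn ℝ Set.univ H)
    (hφ : ∀ x, HasFDerivAt Φ (φ x) x) (hh : ∀ z, HasFDerivAt H (h z) z)
    -- growth of `φ`
    (α γ : ℝ) (hα : 1 < α) (hγ : 0 < γ) (hgrowth : ∀ v : E, γ * ‖v‖ ^ α ≤ φ v v)
    -- `‖h‖` is bounded on the ball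
    (ρ : ℝ) (hρ : 0 < ρ)
    (hbdd : ∃ β : ℝ, ∀ x ∈ Metric.closedBall (0 : E) ρ, ‖h (ι x)‖ ≤ β) :
    ∃ lamStar : ℝ, 0 < lamStar ∧ ∀ lam ∈ Set.Ioc 0 lamStar,
      -- `J` has a minimizer over the closed ball
      (∃ u ∈ Metric.closedBall (0 : E) ρ,
        IsMinOn (actionFunctional ι Φ H lam) (Metric.closedBall (0 : E) ρ) u) ∧
      ∀ u ∈ Metric.closedBall (0 : E) ρ,
        IsMinOn (actionFunctional ι Φ H lam) (Metric.closedBall (0 : E) ρ) u →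
        -- every such minimizer is a critical point and solves the Euler–Lagrange equation
        IsCriticalPoint (actionFunctional ι Φ H lam) u ∧
        φ u = lam • (h (ι u)).comp ι ∧
        -- nontriviality
        ((∃ v ∈ Metric.closedBall (0 : E) ρ, actionFunctional ι Φ H lam v < 0) →
          actionFunctional ι Φ H lam 0 = 0 → u ≠ 0) ∧
        -- the second critical point
        (PalaisSmale (actionFunctional ι Φ H lam) →
          (∃ ρ₁ : ℝ, ‖u‖ < ρ₁ ∧ (actionFunctional ι Φ H lam u : EReal) <
            ⨅ x ∈ Metric.sphere (0 : E) ρ₁, (actionFunctional ι Φ H lam x : EReal)) →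
          (∃ w : E, Tendsto (fun t : ℝ => actionFunctional ι Φ H lam (t • w)) atTop atBot) →
          ∃ z : E, IsCriticalPoint (actionFunctional ι Φ H lam) z ∧ z ≠ 0 ∧ z ≠ u) := by
  have hΦ_gap : ∀ x ∈ Metric.sphere (0 : E) ρ, Φ 0 + γ / α * ρ ^ α ≤ Φ x := fun x hx =>
    mem_sphere_zero_iff_norm.1 hx ▸
      add_div_mul_norm_rpow_le_of_hasFDerivAt (by linarith) hφ hgrowth x
  have hH : ContDiff ℝ 1 H := contDiff_one_of_convexOn hHconv fun z => (hh z).differentiableAt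
  obtain ⟨lamStar, hpos, hmain⟩ := theorem2_general hE hι.compact hΦconv hH hφ hh
    (by positivity) hρ.le hΦ_gap
  refine ⟨lamStar, hpos, fun lam hlam => ?_⟩
  obtain ⟨hexists, hcritical⟩ := hmain lam ((abs_of_pos hlam.1).trans_le hlam.2)
  refine ⟨hexists, fun u hu hmin => ?_⟩
  obtain ⟨hu_crit, heuler, hu_ne, hsecond⟩ := hcritical u hu hmin
  exact ⟨hu_crit, heuler, hu_ne, fun hPS _ => hsecond hPS⟩
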